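/- **Setting.** Let $n,r\in\mathbb N$, $\mathbf x_0\in\mathbb R^n$, $\alpha\in\mathbb R$. All functions and distributions are complex valued. *Test functions and distributions.* Let $M:[0,\infty)\to[0,\infty)$ be continuous, increasing and not identically zero, with $M(t)+M(s)\le M(t+s)$ and $M(t+s)\le M(2t)+M(2s)$ for all $t,s\geq 0$. Let $\mathcal K_{M,r}(\mathbb R^n)$ be the space of all $\varphi\in C^r(\mathbb R^n)$ such that $\lim_{|\mathbf x|\to\infty}e^{M(l|\mathbf x|)}\varphi^{(\beta)}(\mathbf x)=0$ for all $l\in\mathbb N$ and $|\beta|\le r$, with the Fréchet topology given by the norms $\sup_{|\beta|\le r,\,\mathbf x}e^{M(l|\mathbf x|)}|\varphi^{(\beta)}(\mathbf x)|$, $l\in\mathbb N$. Let $\mathcal S_r(\mathbb R^n)$ be defined in the same way with $(1+|\mathbf x|)^l$ in place of $e^{M(l|\mathbf x|)}$. Their duals $\mathcal K'_{M,r}(\mathbb R^n)$ and $\mathcal S'_r(\mathbb R^n)$ carry the strong topology (uniform convergence on bounded sets). For $\mathbf a\in\mathbb R^n$ and $c>0$ put $\langle f(\mathbf a+c\mathbf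 x),\varphi(\mathbf x)\rangle=c^{-n}\langle f(\mathbf y),\varphi((\mathbf y-\mathbf a)/c)\rangle$. *Slowly varying functions.* Let $L$ be a real function that is defined, measurable and positive on some interval $(0,A]$, $A>0$, with $\lim_{\varepsilon\to0^+}L(a\varepsilon)/L(\varepsilon)=1$ for each $a>0$. *MRA.* Let $\{V_j\}_{j\in\mathbb Z}$ be a multiresolution analysis of $L^2(\mathbb R^n)$: an increasing sequence of closed subspaces with $f\in V_j\Leftrightarrow f(2\,\cdot)\in V_{j+1}$; $f\in V_0\Leftrightarrow f(\cdot-\mathbf m)\in V_0$ for $\mathbf m\in\mathbb Z^n$; $\bigcap_jV_j=\{0\}$ and $\overline{\bigcup_jV_j}=L^2(\mathbb R^n)$; and there is a scaling function, that is, a $\phi$ such that $\{\phi(\cdot-\mathbf m)\}_{\mathbf m\in\mathbb Z^n}$ is an orthonormal basis of $V_0$. The MRA is called $(M,r)$-regular (resp. $r$-regular) if $\phi$ can be chosen in $\mathcal K_{M,r}(\mathbb R^n)$ (resp. $\mathcal S_r(\mathbb R^n)$), and then such a $\phi$ is fixed. For $\lambda\in\mathbb R$ let $$q_0(\mathbf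 x,\mathbf y)=\sum_{\mathbf m\in\mathbb Z^n}\phi(\mathbf x-\mathbf m)\overline{\phi(\mathbf y-\mathbf m)},\qquad q_\lambda(\mathbf x,\mathbf y)=2^{n\lambda}q_0(2^\lambda\mathbf x,2^\lambda\mathbf y),\qquad (q_\lambda f)(\mathbf x)=\langle f(\mathbf y),q_\lambda(\mathbf x,\mathbf y)\rangle$$ for $f\in\mathcal K'_{M,r}(\mathbb R^n)$ (resp. $\mathcal S'_r(\mathbb R^n)$); this makes sense because $q_\lambda(\mathbf x,\cdot)$ belongs to $\mathcal K_{M,r}(\mathbb R^n)$ (resp. $\mathcal S_r(\mathbb R^n)$). **Theorem.** Suppose that the MRA is $(M,r)$-regular (resp. $r$-regular), and let $f,g\in\mathcal K'_{M,r}(\mathbb R^n)$ (resp. $\mathcal S'_r(\mathbb R^n)$) satisfy $$\lim_{\varepsilon\to0^+}\frac{f(\mathbf x_0+\varepsilon\mathbf x)}{\varepsilon^\alpha L(\varepsilon)}=g(\mathbf x)\quad\text{strongly in }\mathcal K'_{M,r}(\mathbb R^n)\ (\text{resp. }\mathcal S'_r(\mathbb R^n)).$$ Then $$(q_\lambda f)(\mathbf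 x_0)=L(2^{-\lambda})\,(q_\lambda g_{\mathbf x_0})(\mathbf x_0)+o\big(2^{-\alpha\lambda}L(2^{-\lambda})\big)\qquad\text{as }\lambda\to\infty\ (\lambda\in\mathbb R),$$ where $g_{\mathbf x_0}(\mathbf y)=g(\mathbf y-\mathbf x_0)$. -/

import Mathlib

open Filter Topology MeasureTheory
open scoped NNReal

noncomputable section

/-- The Euclidean space `ℝⁿ`. -/
abbrev Euc (n : ℕ) : Type := EuclideanSpace ℝ (Fin n)

/-! ### Weights -/

/-- The functions `M : [0,∞) → [0,∞)` that measure exponential growth: continuous, increasing,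
not identically zero, with `M t + M s ≤ M (t + s)` and `M (t + s) ≤ M (2 t) + M (2 s)`. -/
structure GrowthFunction where
  toFun : ℝ≥0 → ℝ≥0
  continuous_toFun : Continuous toFun
  monotone_toFun : Monotone toFun
  superadditive : ∀ t s, toFun t + toFun s ≤ toFun (t + s)
  doubling : ∀ t s, toFun (t + s) ≤ toFun (2 * t) + toFun (2 * s)
  nontrivial : ∃ t, toFun t ≠ 0

/-- A sequence of weights on `ℝⁿ` with the elementary properties needed to build the test function
spaces and the operations on them. The two instances of interest are `expWeights` and
`polyWeights` below. -/
structure WeightSeq (n : ℕ) where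
  w : ℕ → Euc n → ℝ
  continuous_w : ∀ l, Continuous (w l)
  one_le : ∀ l x, 1 ≤ w l x
  add_le : ∀ l, ∃ l', ∀ x y, w l (x + y) ≤ w l' x * w l' y
  smul_le : ∀ l (c : ℝ), ∃ l' C, ∀ x, w l (c • x) ≤ C * w l' x
  gain : ∀ l p : ℕ, ∃ l' C, ∀ x, w l x * (1 + ‖x‖) ^ p ≤ C * w l' x

/-- An elementary lower bound: `exp (M s)` dominates every power of `1 + s`. -/
theorem GrowthFunction.pow_le_exp (M : GrowthFunction) (p : ℕ) :
    ∃ C : ℝ, ∀ s : ℝ≥0, (1 + (s : ℝ)) ^ p ≤ C * Real.exp (M.toFun s) := by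
  obtain ⟨t, ht⟩ := M.nontrivial
  have h0 : M.toFun 0 = 0 := by
    have := M.superadditive 0 0
    simpa using this
  have ht0 : t ≠ 0 := by rintro rfl; exact ht h0
  have hmul : ∀ k : ℕ, (k : ℝ≥0) * M.toFun t ≤ M.toFun (k * t) := by
    intro k
    induction k with
    | zero => simp
    | succ k ih =>
      push_cast
      rw [add_mul, add_mul, one_mul, one_mul]
      exact (add_le_add_left ih _).trans (M.superadditive _ _)
  have htR : (0 : ℝ) < t := by positivity
  have hc : (0 : ℝ) < M.toFun t := by positivity
  set a : ℝ := M.toFun t / t with ha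
  have ha0 : 0 < a := by positivity
  have hlow : ∀ s : ℝ≥0, a * s - M.toFun t ≤ M.toFun s := by
    intro s
    have h1 : (s : ℝ) / t - 1 ≤ ⌊(s / t : ℝ≥0)⌋₊ := by
      have := Nat.lt_floor_add_one (s / t : ℝ≥0)
      have h2 : ((s / t : ℝ≥0) : ℝ) < (⌊(s / t : ℝ≥0)⌋₊ : ℝ) + 1 := by exact_mod_cast this
      rw [NNReal.coe_div] at h2
      linarith
    have h2 : ((⌊(s / t : ℝ≥0)⌋₊ : ℝ≥0)) * t ≤ s := by
      have := Nat.floor_le (a := (s / t : ℝ≥0)) (by positivity)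
      calc _ ≤ (s / t) * t := by gcongr
        _ = s := by field_simp
    have h3 := (hmul ⌊(s / t : ℝ≥0)⌋₊).trans (M.monotone_toFun h2)
    have h4 : ((⌊(s / t : ℝ≥0)⌋₊ : ℝ)) * M.toFun t ≤ M.toFun s := by exact_mod_cast h3
    have h5 : ((s : ℝ) / t - 1) * M.toFun t ≤ M.toFun s :=
      (mul_le_mul_of_nonneg_right h1 hc.le).trans h4
    calc _ = ((s : ℝ) / t - 1) * M.toFun t := by rw [ha]; field_simp
      _ ≤ _ := h5
  refine ⟨p.factorial / a ^ p * Real.exp (a + M.toFun t), fun s => ?_⟩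
  have h1 := Real.pow_div_factorial_le_exp (a * (1 + s)) (by positivity) p
  rw [div_le_iff₀ (by positivity), mul_pow] at h1
  have h2 : Real.exp (a * (1 + s)) ≤ Real.exp (a + M.toFun t) * Real.exp (M.toFun s) := by
    rw [← Real.exp_add]
    apply Real.exp_le_exp.2
    have := hlow s
    linarith
  calc (1 + (s : ℝ)) ^ p = (a ^ p * (1 + (s : ℝ)) ^ p) / a ^ p := by field_simp
    _ ≤ (Real.exp (a + M.toFun t) * Real.exp (M.toFun s) * p.factorial) / a ^ p := by
        exact div_le_div_of_nonneg_right (h1.trans (by gcongr)) (by positivity)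
    _ = _ := by ring

/-- The weights `e^{M(l|x|)}`, `l ∈ ℕ`. -/
def expWeights (M : GrowthFunction) (n : ℕ) : WeightSeq n where
  w l x := Real.exp (M.toFun (l * ‖x‖₊))
  continuous_w l := by
    have := M.continuous_toFun
    fun_prop
  one_le l x := Real.one_le_exp (by positivity)
  add_le l := by
    refine ⟨2 * l, fun x y => ?_⟩
    rw [← Real.exp_add]
    apply Real.exp_le_exp.2
    have h : M.toFun (l * ‖x + y‖₊)
        ≤ M.toFun (2 * (l * ‖x‖₊)) + M.toFun (2 * (l * ‖y‖₊)) := by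
      refine (M.monotone_toFun ?_).trans (M.doubling _ _)
      rw [← mul_add]
      gcongr
      exact nnnorm_add_le x y
    push_cast
    rw [mul_assoc, mul_assoc]
    exact_mod_cast h
  smul_le l c := by
    refine ⟨⌈(l : ℝ≥0) * ‖c‖₊⌉₊, 1, fun x => ?_⟩
    rw [one_mul]
    apply Real.exp_le_exp.2
    refine NNReal.coe_le_coe.2 (M.monotone_toFun ?_)
    rw [nnnorm_smul, ← mul_assoc]
    gcongr
    exact Nat.le_ceil _
  gain l p := by
    obtain ⟨C, hC⟩ := M.pow_le_exp p
    refine ⟨l + 1, C, fun x => ?_⟩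
    have h1 := hC ‖x‖₊
    have hC0 : 0 ≤ C := by
      have h3 : (0 : ℝ) < C * Real.exp (M.toFun ‖x‖₊) :=
        lt_of_lt_of_le (by positivity) h1
      exact (pos_of_mul_pos_left h3 (Real.exp_pos _).le).le
    have h2 : M.toFun (l * ‖x‖₊) + M.toFun ‖x‖₊ ≤ M.toFun ((l + 1 : ℕ) * ‖x‖₊) := by
      refine (M.superadditive _ _).trans_eq ?_
      push_cast
      rw [add_mul, one_mul]
    rw [coe_nnnorm] at h1
    calc Real.exp (M.toFun (l * ‖x‖₊)) * (1 + ‖x‖) ^ p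
        ≤ Real.exp (M.toFun (l * ‖x‖₊)) * (C * Real.exp (M.toFun ‖x‖₊)) := by gcongr
      _ = C * Real.exp (M.toFun (l * ‖x‖₊) + M.toFun ‖x‖₊) := by rw [Real.exp_add]; ring
      _ ≤ _ := by gcongr; exact_mod_cast h2

/-- The weights `(1+|x|)^l`, `l ∈ ℕ`. -/
def polyWeights (n : ℕ) : WeightSeq n where
  w l x := (1 + ‖x‖) ^ l
  continuous_w l := by fun_prop
  one_le l x := one_le_pow₀ (by linarith [norm_nonneg x])
  add_le l := by
    refine ⟨l, fun x y => ?_⟩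
    rw [← mul_pow]
    gcongr
    have := norm_add_le x y
    nlinarith [mul_nonneg (norm_nonneg x) (norm_nonneg y)]
  smul_le l c := by
    refine ⟨l, (1 + |c|) ^ l, fun x => ?_⟩
    rw [← mul_pow]
    gcongr
    rw [norm_smul, Real.norm_eq_abs]
    nlinarith [abs_nonneg c, norm_nonneg x]
  gain l p := ⟨l + p, 1, fun x => by rw [one_mul, pow_add]⟩

/-! ### Test function spaces -/

/-- The `C^r` functions `φ : ℝⁿ → ℂ` such that `w_l(x) φ^{(α)}(x) → 0` as `|x| → ∞`, for every `l`
and every order of differentiation `k = |α| ≤ r`. The norm of the full `k`-th derivative is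
comparable with the largest of the partial derivatives of order `k`. -/
def testSubmodule {n : ℕ} (W : WeightSeq n) (r : ℕ) : Submodule ℂ (Euc n → ℂ) where
  carrier := {φ | ContDiff ℝ r φ ∧ ∀ l k : ℕ, k ≤ r →
    Tendsto (fun x => W.w l x * ‖iteratedFDeriv ℝ k φ x‖) (cocompact (Euc n)) (𝓝 0)}
  zero_mem' := by
    refine ⟨contDiff_const, fun l k _ => ?_⟩
    have h : iteratedFDeriv ℝ k (0 : Euc n → ℂ) = 0 := iteratedFDeriv_fun_zero
    simpa [h] using tendsto_const_nhds
  add_mem' := by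
    rintro φ ψ ⟨hφ, hφ'⟩ ⟨hψ, hψ'⟩
    refine ⟨hφ.add hψ, fun l k hk => ?_⟩
    have h := (hφ' l k hk).add (hψ' l k hk)
    rw [add_zero] at h
    refine squeeze_zero (fun x => ?_) (fun x => ?_) h
    · exact mul_nonneg (zero_le_one.trans (W.one_le l x)) (norm_nonneg _)
    · rw [iteratedFDeriv_add_apply (hφ.of_le (mod_cast hk)).contDiffAt
        (hψ.of_le (mod_cast hk)).contDiffAt, ← mul_add]
      exact mul_le_mul_of_nonneg_left (norm_add_le _ _) (zero_le_one.trans (W.one_le l x))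
  smul_mem' := by
    rintro c φ ⟨hφ, hφ'⟩
    refine ⟨contDiff_const.smul hφ, fun l k hk => ?_⟩
    have h := (hφ' l k hk).const_mul ‖c‖
    rw [mul_zero] at h
    refine h.congr fun x => ?_
    rw [iteratedFDeriv_const_smul_apply (hφ.of_le (mod_cast hk)).contDiffAt, norm_smul]
    ring

/-- The space of test functions attached to a weight sequence and an order of smoothness. It is
a copy of `testSubmodule W r` that carries its own Fréchet topology. -/
def TestSpace {n : ℕ} (W : WeightSeq n) (r : ℕ) : Type := testSubmodule W r

namespace TestSpace

variable {n : ℕ} {W : WeightSeq n} {r : ℕ}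

instance : AddCommGroup (TestSpace W r) := inferInstanceAs (AddCommGroup (testSubmodule W r))

instance : Module ℂ (TestSpace W r) := inferInstanceAs (Module ℂ (testSubmodule W r))

/-- The function underlying a test function. -/
def fn (φ : TestSpace W r) : Euc n → ℂ := φ.1

theorem fn_mem (φ : TestSpace W r) : φ.fn ∈ testSubmodule W r := φ.2

theorem contDiff (φ : TestSpace W r) : ContDiff ℝ r φ.fn := φ.2.1

theorem tendsto (φ : TestSpace W r) (l : ℕ) {k : ℕ} (hk : k ≤ r) :
    Tendsto (fun x => W.w l x * ‖iteratedFDeriv ℝ k φ.fn x‖) (cocompact (Euc n)) (𝓝 0) :=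
  φ.2.2 l k hk

@[ext]
theorem ext {φ ψ : TestSpace W r} (h : φ.fn = ψ.fn) : φ = ψ := Subtype.ext h

theorem fn_add (φ ψ : TestSpace W r) : (φ + ψ).fn = φ.fn + ψ.fn := rfl

theorem fn_smul (c : ℂ) (φ : TestSpace W r) : (c • φ).fn = c • φ.fn := rfl

theorem fn_zero : (0 : TestSpace W r).fn = 0 := rfl

theorem bddAbove (φ : TestSpace W r) (l : ℕ) :
    BddAbove (Set.range fun q : Fin (r + 1) × Euc n =>
      W.w l q.2 * ‖iteratedFDeriv ℝ q.1 φ.fn q.2‖) := by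
  have h : ∀ k : Fin (r + 1), ∃ C, ∀ x, W.w l x * ‖iteratedFDeriv ℝ k φ.fn x‖ ≤ C := by
    intro k
    have hk : (k : ℕ) ≤ r := Nat.lt_succ_iff.1 k.2
    have hev := (φ.tendsto l hk).eventually_le_const zero_lt_one
    obtain ⟨K, hK, hKs⟩ := mem_cocompact.1 hev
    have hcont : Continuous fun x => W.w l x * ‖iteratedFDeriv ℝ k φ.fn x‖ :=
      (W.continuous_w l).mul (φ.contDiff.continuous_iteratedFDeriv (mod_cast hk)).norm
    obtain ⟨C, hC⟩ := (hK.image hcont).bddAbove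
    refine ⟨max C 1, fun x => ?_⟩
    by_cases hx : x ∈ K
    · exact (hC ⟨x, hx, rfl⟩).trans (le_max_left _ _)
    · exact (hKs hx : _ ≤ (1 : ℝ)).trans (le_max_right _ _)
  choose C hC using h
  refine ⟨∑ k, |C k|, ?_⟩
  rintro _ ⟨q, rfl⟩
  exact ((hC q.1 q.2).trans (le_abs_self _)).trans
    (Finset.single_le_sum (f := fun k => |C k|) (fun _ _ => abs_nonneg _) (Finset.mem_univ q.1))

/-- The norm `sup_{k ≤ r, x} w_l(x) ‖φ^{(k)}(x)‖`. -/
def norm (W : WeightSeq n) (r l : ℕ) : Seminorm ℂ (TestSpace W r) :=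
  Seminorm.ofSMulLE
    (fun φ => ⨆ q : Fin (r + 1) × Euc n, W.w l q.2 * ‖iteratedFDeriv ℝ q.1 φ.fn q.2‖)
    (by
      have h : ∀ k : ℕ, iteratedFDeriv ℝ k (0 : Euc n → ℂ) = 0 := fun _ => iteratedFDeriv_fun_zero
      simp [fn_zero, h])
    (by
      intro φ ψ
      refine ciSup_le fun q => ?_
      have hq : (q.1 : ℕ) ≤ r := Nat.lt_succ_iff.1 q.1.2
      have hw := zero_le_one.trans (W.one_le l q.2)
      rw [fn_add, iteratedFDeriv_add_apply (φ.contDiff.of_le (mod_cast hq)).contDiffAt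
        (ψ.contDiff.of_le (mod_cast hq)).contDiffAt]
      refine (mul_le_mul_of_nonneg_left (norm_add_le _ _) hw).trans ?_
      rw [mul_add]
      exact add_le_add (le_ciSup (φ.bddAbove l) q) (le_ciSup (ψ.bddAbove l) q))
    (by
      intro c φ
      refine ciSup_le fun q => ?_
      have hq : (q.1 : ℕ) ≤ r := Nat.lt_succ_iff.1 q.1.2
      rw [fn_smul, iteratedFDeriv_const_smul_apply (φ.contDiff.of_le (mod_cast hq)).contDiffAt,
        norm_smul, mul_left_comm]
      exact mul_le_mul_of_nonneg_left (le_ciSup (φ.bddAbove l) q) (norm_nonneg _))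

theorem le_norm (φ : TestSpace W r) (l : ℕ) {k : ℕ} (hk : k ≤ r) (x : Euc n) :
    W.w l x * ‖iteratedFDeriv ℝ k φ.fn x‖ ≤ norm W r l φ :=
  le_ciSup (φ.bddAbove l) ((⟨k, Nat.lt_succ_iff.2 hk⟩, x) : Fin (r + 1) × Euc n)

theorem norm_le (φ : TestSpace W r) (l : ℕ) {C : ℝ}
    (h : ∀ k ≤ r, ∀ x, W.w l x * ‖iteratedFDeriv ℝ k φ.fn x‖ ≤ C) : norm W r l φ ≤ C :=
  ciSup_le fun q : Fin (r + 1) × Euc n => h q.1 (Nat.lt_succ_iff.1 q.1.2) q.2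

/-- The norms `norm W r l`, `l ∈ ℕ`, as a family. -/
def family (W : WeightSeq n) (r : ℕ) : SeminormFamily ℂ (TestSpace W r) ℕ := norm W r

/-- The projective limit topology, i.e. the one given by the norms `norm W r l`, `l ∈ ℕ`. -/
instance : TopologicalSpace (TestSpace W r) :=
  (family W r).moduleFilterBasis.topology

theorem withSeminorms : WithSeminorms (family W r) := ⟨rfl⟩

instance : IsTopologicalAddGroup (TestSpace W r) := withSeminorms.topologicalAddGroup

instance : ContinuousSMul ℂ (TestSpace W r) := withSeminorms.continuousSMul

/-- Derivatives of `x ↦ φ (c x + b)`. -/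
theorem norm_iteratedFDeriv_affine {φ : Euc n → ℂ} {k : ℕ} (hφ : ContDiff ℝ k φ) (c : ℝ)
    (b x : Euc n) : ‖iteratedFDeriv ℝ k (fun x => φ (c • x + b)) x‖
      = |c| ^ k * ‖iteratedFDeriv ℝ k φ (c • x + b)‖ := by
  have h1 : ContDiff ℝ k fun z => φ (z + b) := hφ.comp (contDiff_id.add contDiff_const)
  have h2 := iteratedFDeriv_comp_const_smul c h1
  rw [h2]
  simp only [norm_smul, norm_pow, Real.norm_eq_abs]
  rw [iteratedFDeriv_comp_add_right]

theorem affine_weight (W : WeightSeq n) (l : ℕ) {c : ℝ} (hc : c ≠ 0) (b : Euc n) :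
    ∃ l' C, 0 ≤ C ∧ ∀ x, W.w l x ≤ C * W.w l' (c • x + b) := by
  obtain ⟨l₁, C, hC⟩ := W.smul_le l c⁻¹
  obtain ⟨l₂, h₂⟩ := W.add_le l₁
  have hC0 : 0 ≤ C := by
    have h := (zero_lt_one.trans_le (W.one_le l (c⁻¹ • (0 : Euc n)))).trans_le (hC 0)
    exact (pos_of_mul_pos_left h (zero_le_one.trans (W.one_le l₁ 0))).le
  refine ⟨l₂, C * W.w l₂ (-b), mul_nonneg hC0 (zero_le_one.trans (W.one_le _ _)), fun x => ?_⟩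
  have h := hC (c • x)
  rw [inv_smul_smul₀ hc] at h
  have h3 := h₂ (c • x + b) (-b)
  rw [add_neg_cancel_right] at h3
  calc W.w l x ≤ C * W.w l₁ (c • x) := h
    _ ≤ C * (W.w l₂ (c • x + b) * W.w l₂ (-b)) := by gcongr
    _ = _ := by ring

theorem affine_mem {φ : Euc n → ℂ} (hφ : φ ∈ testSubmodule W r) {c : ℝ} (hc : c ≠ 0)
    (b : Euc n) : (fun x => φ (c • x + b)) ∈ testSubmodule W r := by
  obtain ⟨h, h'⟩ := hφ
  refine ⟨h.comp ((contDiff_id.const_smul c).add contDiff_const), fun l k hk => ?_⟩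
  obtain ⟨l', C, hC0, hC⟩ := affine_weight W l hc b
  have hemb : Topology.IsClosedEmbedding fun x : Euc n => c • x + b :=
    ((Homeomorph.smulOfNeZero c hc).trans (Homeomorph.addRight b)).isClosedEmbedding
  have ht := ((h' l' k hk).comp hemb.tendsto_cocompact).const_mul (C * |c| ^ k)
  rw [mul_zero] at ht
  refine squeeze_zero (fun x => ?_) (fun x => ?_) ht
  · exact mul_nonneg (zero_le_one.trans (W.one_le l x)) (norm_nonneg _)
  · rw [norm_iteratedFDeriv_affine (h.of_le (mod_cast hk))]
    calc _ ≤ (C * W.w l' (c • x + b)) * (|c| ^ k * ‖iteratedFDeriv ℝ k φ (c • x + b)‖) := by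
            gcongr; exact hC x
      _ = _ := by simp only [Function.comp]; ring

/-- The continuous linear operator `φ ↦ φ(c · + b)` on test functions, `c ≠ 0`. -/
def compAffine (W : WeightSeq n) (r : ℕ) (c : ℝ) (hc : c ≠ 0) (b : Euc n) :
    TestSpace W r →L[ℂ] TestSpace W r where
  toFun φ := ⟨fun x => φ.fn (c • x + b), affine_mem φ.fn_mem hc b⟩
  map_add' _ _ := rfl
  map_smul' _ _ := rfl
  cont := by
    let T : TestSpace W r →ₗ[ℂ] TestSpace W r :=
      { toFun := fun φ => ⟨fun x => φ.fn (c • x + b), affine_mem φ.fn_mem hc b⟩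
        map_add' := fun _ _ => rfl
        map_smul' := fun _ _ => rfl }
    change Continuous T
    refine WithSeminorms.continuous_of_isBounded withSeminorms withSeminorms T fun l => ?_
    obtain ⟨l', C, hC0, hC⟩ := affine_weight W l hc b
    have hS : 0 ≤ C * (1 + |c|) ^ r := by positivity
    refine ⟨{l'}, ⟨C * (1 + |c|) ^ r, hS⟩, fun φ => ?_⟩
    rw [Finset.sup_singleton]
    refine norm_le _ l fun k hk x => ?_
    change W.w l x * ‖iteratedFDeriv ℝ k (fun x => φ.fn (c • x + b)) x‖
      ≤ (C * (1 + |c|) ^ r) * norm W r l' φ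
    rw [norm_iteratedFDeriv_affine (φ.contDiff.of_le (mod_cast hk))]
    have hck : |c| ^ k ≤ (1 + |c|) ^ r :=
      (pow_le_pow_left₀ (abs_nonneg c) (by linarith) k).trans
        (pow_le_pow_right₀ (by linarith [abs_nonneg c]) hk)
    calc _ ≤ (C * W.w l' (c • x + b))
            * ((1 + |c|) ^ r * ‖iteratedFDeriv ℝ k φ.fn (c • x + b)‖) := by
          gcongr
          · exact mul_nonneg hC0 (zero_le_one.trans (W.one_le _ _))
          · exact hC x
      _ = (C * (1 + |c|) ^ r)
            * (W.w l' (c • x + b) * ‖iteratedFDeriv ℝ k φ.fn (c • x + b)‖) := by ring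
      _ ≤ _ := mul_le_mul_of_nonneg_left (φ.le_norm l' hk _) hS

theorem compAffine_fn (c : ℝ) (hc : c ≠ 0) (b : Euc n) (φ : TestSpace W r) (x : Euc n) :
    (compAffine W r c hc b φ).fn x = φ.fn (c • x + b) := rfl

end TestSpace

/-! ### Distributions -/

/-- The space of distributions that is dual to a test function space. As a topological vector space
it is the strong dual: the topology is that of uniform convergence on bounded sets. -/
abbrev Distr {n : ℕ} (W : WeightSeq n) (r : ℕ) : Type := StrongDual ℂ (TestSpace W r)

/-- The affine change of variables `x ↦ f(a + c x)` of a distribution: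
`⟨f(a + c x), φ(x)⟩ = |c|^{-n} ⟨f(y), φ((y - a)/c)⟩` for `c ≠ 0` (and, by convention, `0` for
`c = 0`). -/
def Distr.affine {n : ℕ} {W : WeightSeq n} {r : ℕ} (f : Distr W r) (a : Euc n) (c : ℝ) :
    Distr W r :=
  if hc : c = 0 then 0
  else (((|c| ^ n)⁻¹ : ℝ) : ℂ) •
    f.comp (TestSpace.compAffine W r c⁻¹ (inv_ne_zero hc) (-(c⁻¹ • a)))

/-- `L` is slowly varying at the origin: it is defined, measurable and positive on some `(0,A]`,
and `L(aε)/L(ε) → 1` as `ε → 0⁺` for each `a > 0`. -/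
def SlowlyVarying (L : ℝ → ℝ) : Prop :=
  (∃ A > 0, AEMeasurable L (volume.restrict (Set.Ioc 0 A)) ∧ ∀ ε ∈ Set.Ioc 0 A, 0 < L ε) ∧
    ∀ a > 0, Tendsto (fun ε => L (a * ε) / L ε) (𝓝[>] 0) (𝓝 1)

/-- `f(x₀ + εx) / (ε^α L(ε)) → g(x)` strongly, as `ε → 0⁺`. -/
def HasStrongQuasiasymptotics {n : ℕ} {W : WeightSeq n} {r : ℕ} (f : Distr W r) (x₀ : Euc n)
    (α : ℝ) (L : ℝ → ℝ) (g : Distr W r) : Prop :=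
  Tendsto (fun ε : ℝ => (((ε ^ α * L ε)⁻¹ : ℝ) : ℂ) • f.affine x₀ ε) (𝓝[>] 0) (𝓝 g)

/-! ### Multiresolution analysis -/

/-- The space `L²(ℝⁿ)`. -/
abbrev L2 (n : ℕ) : Type := Lp ℂ 2 (volume : Measure (Euc n))

/-- A point of the lattice `ℤⁿ`, as a vector of `ℝⁿ`. -/
def latticePt {n : ℕ} (m : Fin n → ℤ) : Euc n := WithLp.toLp 2 fun i => (m i : ℝ)

/-- The integer translates of `φ` form an orthonormal basis of the subspace `V₀` of `L²(ℝⁿ)`. -/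
def IsScalingFunction {n : ℕ} (V₀ : Submodule ℂ (L2 n)) (φ : Euc n → ℂ) : Prop :=
  ∃ b : HilbertBasis (Fin n → ℤ) ℂ V₀,
    ∀ m, (((b m : V₀) : L2 n) : Euc n → ℂ) =ᵐ[volume] fun x => φ (x - latticePt m)

/-- A multiresolution analysis of `L²(ℝⁿ)`. -/
structure MRA (n : ℕ) where
  V : ℤ → Submodule ℂ (L2 n)
  isClosed_V : ∀ j, IsClosed (V j : Set (L2 n))
  monotone_V : Monotone V
  dilation : ∀ j (f g : L2 n), (g : Euc n → ℂ) =ᵐ[volume] (fun x => f ((2 : ℝ) • x)) →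
    (f ∈ V j ↔ g ∈ V (j + 1))
  translation : ∀ (m : Fin n → ℤ) (f g : L2 n),
    (g : Euc n → ℂ) =ᵐ[volume] (fun x => f (x - latticePt m)) → (f ∈ V 0 ↔ g ∈ V 0)
  iInf_V : ⨅ j, V j = ⊥
  dense_V : (⨆ j, V j).topologicalClosure = ⊤
  exists_scaling : ∃ φ, IsScalingFunction (V 0) φ

/-- The reproducing kernel `q₀(x,y) = ∑_{m ∈ ℤⁿ} φ(x-m) conj(φ(y-m))`. -/
def kernel₀ {n : ℕ} (φ : Euc n → ℂ) (x y : Euc n) : ℂ :=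
  ∑' m : Fin n → ℤ, φ (x - latticePt m) * (starRingEnd ℂ) (φ (y - latticePt m))

/-- The kernel `q_s(x,y) = 2^{ns} q₀(2^s x, 2^s y)`, for real `s`. -/
def kernel {n : ℕ} (φ : Euc n → ℂ) (s : ℝ) (x y : Euc n) : ℂ :=
  (((2 : ℝ) ^ (n * s) : ℝ) : ℂ) * kernel₀ φ ((2 : ℝ) ^ s • x) ((2 : ℝ) ^ s • y)

theorem summable_lattice {n : ℕ} (x : Euc n) :
    Summable fun m : Fin n → ℤ => ((1 + ‖x - latticePt m‖) ^ (n + 1))⁻¹ := by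
  let b := (EuclideanSpace.basisFun (Fin n) ℝ).toBasis
  let Λ : Submodule ℤ (Euc n) := Submodule.span ℤ (Set.range b)
  have hmem : ∀ m : Fin n → ℤ, latticePt m ∈ Λ := by
    intro m
    have : latticePt m = ∑ i, m i • b i := by
      ext j
      simp [latticePt, b, Finset.sum_apply, Pi.single_apply]
    rw [this]
    exact Submodule.sum_mem _ fun i _ =>
      Submodule.smul_mem _ _ (Submodule.subset_span ⟨i, rfl⟩)
  have hinj : Function.Injective (latticePt : (Fin n → ℤ) → Euc n) := by
    intro m m' h
    funext i
    have := congrArg (fun v : Euc n => v i) h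
    simpa [latticePt] using this
  have hrank : Module.finrank ℤ Λ < n + 1 := by
    have : Module.finrank ℤ Λ = n := by
      rw [ZLattice.rank ℝ Λ]; simp
    omega
  have hs := ZLattice.summable_norm_sub_inv_pow Λ (n + 1) hrank x
  have hs' := hs.comp_injective (i := fun m : Fin n → ℤ => (⟨latticePt m, hmem m⟩ : Λ))
    fun m m' h => hinj (congrArg Subtype.val h)
  refine Summable.of_norm_bounded_eventually hs' ?_
  have hfin : {m : Fin n → ℤ | latticePt m = x}.Finite :=
    Set.Subsingleton.finite fun m hm m' hm' => hinj (hm.trans hm'.symm)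
  filter_upwards [hfin.compl_mem_cofinite] with m hm
  have hpos : 0 < ‖latticePt m - x‖ := norm_pos_iff.2 (sub_ne_zero.2 hm)
  simp only [Function.comp]
  rw [norm_inv, norm_pow, Real.norm_of_nonneg (by positivity), norm_sub_rev x, inv_pow]
  gcongr
  linarith

/-- Each term of the series for `q₀(x, ·)`, with weights and derivatives, is dominated by a term
of a convergent series that does not depend on `y`. -/
theorem kernel₀_term_bound {n : ℕ} {W : WeightSeq n} {r : ℕ} (φ : TestSpace W r) (x : Euc n)
    (l : ℕ) : ∃ B : (Fin n → ℤ) → ℝ, Summable B ∧ ∀ k ≤ r, ∀ m y, W.w l y *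
      ‖iteratedFDeriv ℝ k (fun y => φ.fn (x - latticePt m) *
        (starRingEnd ℂ) (φ.fn (y - latticePt m))) y‖ ≤ B m := by
  obtain ⟨l₁, h₁⟩ := W.add_le l
  obtain ⟨l₂, h₂⟩ := W.add_le l₁
  obtain ⟨l₃, C₃, h₃⟩ := W.smul_le l₂ (-1)
  obtain ⟨l₄, C₄, h₄⟩ := W.gain l₃ (n + 1)
  have w0 : ∀ l x, 0 < W.w l x := fun l x => zero_lt_one.trans_le (W.one_le l x)
  have hC₃ : 0 ≤ C₃ :=
    (pos_of_mul_pos_left ((w0 _ _).trans_le (h₃ 0)) (w0 l₃ 0).le).le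
  have hC₄ : 0 ≤ C₄ := by
    have := h₄ 0
    refine (pos_of_mul_pos_left (lt_of_lt_of_le ?_ this) (w0 l₄ 0).le).le
    exact mul_pos (w0 _ _) (by simp)
  have hB : 0 ≤ W.w l₂ x * C₃ * C₄ * TestSpace.norm W r l₄ φ :=
    mul_nonneg (mul_nonneg (mul_nonneg (w0 _ _).le hC₃) hC₄) (apply_nonneg _ _)
  refine ⟨fun m => (W.w l₂ x * C₃ * C₄ * TestSpace.norm W r l₄ φ * TestSpace.norm W r l₁ φ) *
    ((1 + ‖x - latticePt m‖) ^ (n + 1))⁻¹, (summable_lattice x).mul_left _, ?_⟩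
  intro k hk m y
  set p := latticePt m with hp
  have hcd : ContDiff ℝ k fun y => (starRingEnd ℂ) (φ.fn (y - p)) :=
    Complex.conjLIE.toContinuousLinearEquiv.contDiff.comp
      ((φ.contDiff.of_le (mod_cast hk)).comp (contDiff_id.sub contDiff_const))
  have hder : ‖iteratedFDeriv ℝ k (fun y => φ.fn (x - p) * (starRingEnd ℂ) (φ.fn (y - p))) y‖
      = ‖φ.fn (x - p)‖ * ‖iteratedFDeriv ℝ k φ.fn (y - p)‖ := by
    have e1 := iteratedFDeriv_const_smul_apply (𝕜 := ℝ) (i := k) (x := y) (a := φ.fn (x - p))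
      hcd.contDiffAt
    have e2 := Complex.conjLIE.norm_iteratedFDeriv_comp_left (𝕜 := ℝ)
      (fun y => φ.fn (y - p)) y k
    have e3 : iteratedFDeriv ℝ k (fun y => φ.fn (y - p)) y = iteratedFDeriv ℝ k φ.fn (y - p) :=
      iteratedFDeriv_comp_sub k p y
    rw [e3] at e2
    change ‖iteratedFDeriv ℝ k (φ.fn (x - p) • fun y => (starRingEnd ℂ) (φ.fn (y - p))) y‖ = _
    rw [e1, norm_smul]
    congr 1
  rw [hder]
  have hy : W.w l y ≤ W.w l₁ p * W.w l₁ (y - p) := by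
    have := h₁ p (y - p); rwa [add_sub_cancel] at this
  have hpw : W.w l₁ p ≤ W.w l₂ x * (C₃ * W.w l₃ (x - p)) := by
    have e := h₂ x (p - x)
    rw [add_sub_cancel] at e
    have e' := h₃ (x - p)
    rw [neg_one_smul, neg_sub] at e'
    exact e.trans (mul_le_mul_of_nonneg_left e' (w0 _ _).le)
  have hx : W.w l₃ (x - p) * ‖φ.fn (x - p)‖
      ≤ C₄ * TestSpace.norm W r l₄ φ * ((1 + ‖x - p‖) ^ (n + 1))⁻¹ := by
    have e1 := h₄ (x - p)
    have e2 := φ.le_norm l₄ (Nat.zero_le r) (x - p)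
    rw [norm_iteratedFDeriv_zero] at e2
    rw [← div_eq_mul_inv, le_div_iff₀ (by positivity)]
    calc _ = (W.w l₃ (x - p) * (1 + ‖x - p‖) ^ (n + 1)) * ‖φ.fn (x - p)‖ := by ring
      _ ≤ (C₄ * W.w l₄ (x - p)) * ‖φ.fn (x - p)‖ := by gcongr
      _ = C₄ * (W.w l₄ (x - p) * ‖φ.fn (x - p)‖) := by ring
      _ ≤ _ := by gcongr
  have hyd := φ.le_norm l₁ hk (y - p)
  calc W.w l y * (‖φ.fn (x - p)‖ * ‖iteratedFDeriv ℝ k φ.fn (y - p)‖)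
      ≤ (W.w l₁ p * W.w l₁ (y - p)) * (‖φ.fn (x - p)‖ * ‖iteratedFDeriv ℝ k φ.fn (y - p)‖) := by
        gcongr
    _ ≤ ((W.w l₂ x * (C₃ * W.w l₃ (x - p))) * W.w l₁ (y - p)) *
          (‖φ.fn (x - p)‖ * ‖iteratedFDeriv ℝ k φ.fn (y - p)‖) := by
        have := (w0 l₁ (y - p)).le
        gcongr
    _ = (W.w l₂ x * C₃) * ((W.w l₃ (x - p) * ‖φ.fn (x - p)‖) *
          (W.w l₁ (y - p) * ‖iteratedFDeriv ℝ k φ.fn (y - p)‖)) := by ring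
    _ ≤ (W.w l₂ x * C₃) * ((C₄ * TestSpace.norm W r l₄ φ * ((1 + ‖x - p‖) ^ (n + 1))⁻¹) *
          TestSpace.norm W r l₁ φ) := by
        have a1 := (w0 l₂ x).le
        have a2 := (w0 l₁ (y - p)).le
        have a3 : 0 ≤ TestSpace.norm W r l₄ φ := apply_nonneg _ _
        gcongr
    _ = _ := by ring

/-- `q₀(x, ·)` is a test function. -/
theorem kernel₀_mem {n : ℕ} {W : WeightSeq n} {r : ℕ} (φ : TestSpace W r) (x : Euc n) :
    kernel₀ φ.fn x ∈ testSubmodule W r := by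
  choose B hB hBm using kernel₀_term_bound φ x
  set F : (Fin n → ℤ) → Euc n → ℂ := fun m y => φ.fn (x - latticePt m) *
    (starRingEnd ℂ) (φ.fn (y - latticePt m)) with hF
  have hcd : ∀ m, ContDiff ℝ ((r : ℕ∞) : WithTop ℕ∞) (F m) := fun m =>
    contDiff_const.mul (Complex.conjLIE.toContinuousLinearEquiv.contDiff.comp
      (φ.contDiff.comp (contDiff_id.sub contDiff_const)))
  have hder : ∀ (k : ℕ) (m : Fin n → ℤ) (y : Euc n), (k : ℕ∞) ≤ (r : ℕ∞) →
      ‖iteratedFDeriv ℝ k (F m) y‖ ≤ B 0 m := by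
    intro k m y hk
    refine le_trans ?_ (hBm 0 k (mod_cast hk) m y)
    exact le_mul_of_one_le_left (norm_nonneg _) (W.one_le 0 y)
  have hsum : ∀ k : ℕ, (k : ℕ∞) ≤ (r : ℕ∞) → Summable (B 0) := fun _ _ => hB 0
  have hbound : ∀ l k : ℕ, k ≤ r → ∀ y,
      W.w l y * ‖iteratedFDeriv ℝ k (kernel₀ φ.fn x) y‖ ≤ ∑' m, B l m := by
    intro l k hk y
    have e : iteratedFDeriv ℝ k (kernel₀ φ.fn x) y = ∑' m, iteratedFDeriv ℝ k (F m) y :=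
      iteratedFDeriv_tsum_apply (v := fun _ => B 0) hcd hsum hder (mod_cast hk) y
    have w0 : 0 < W.w l y := zero_lt_one.trans_le (W.one_le l y)
    rw [e, mul_comm, ← le_div_iff₀ w0, ← tsum_div_const]
    refine tsum_of_norm_bounded ((hB l).div_const _).hasSum fun m => ?_
    rw [le_div_iff₀ w0, mul_comm]
    exact hBm l k hk m y
  refine ⟨contDiff_tsum (v := fun _ => B 0) hcd hsum hder, fun l k hk => ?_⟩
  obtain ⟨l', C, hC⟩ := W.gain l 1
  have hC0 : 0 ≤ C := by
    have h0 := hC 0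
    have a1 : 0 < W.w l (0 : Euc n) := zero_lt_one.trans_le (W.one_le _ _)
    have a2 : 0 < W.w l' (0 : Euc n) := zero_lt_one.trans_le (W.one_le _ _)
    simp only [norm_zero, add_zero, one_pow, mul_one] at h0
    exact (pos_of_mul_pos_left (a1.trans_le h0) a2.le).le
  have hlim : Tendsto (fun y : Euc n => (C * ∑' m, B l' m) / (1 + ‖y‖))
      (cocompact (Euc n)) (𝓝 0) :=
    Tendsto.const_div_atTop
      (tendsto_atTop_add_const_left _ _ (tendsto_norm_cocompact_atTop (E := Euc n))) _
  refine squeeze_zero (fun y => ?_) (fun y => ?_) hlim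
  · exact mul_nonneg (zero_le_one.trans (W.one_le l y)) (norm_nonneg _)
  · rw [le_div_iff₀ (by positivity)]
    have h1 := hC y
    rw [pow_one] at h1
    calc _ = (W.w l y * (1 + ‖y‖)) * ‖iteratedFDeriv ℝ k (kernel₀ φ.fn x) y‖ := by ring
      _ ≤ (C * W.w l' y) * ‖iteratedFDeriv ℝ k (kernel₀ φ.fn x) y‖ := by gcongr
      _ = C * (W.w l' y * ‖iteratedFDeriv ℝ k (kernel₀ φ.fn x) y‖) := by ring
      _ ≤ _ := mul_le_mul_of_nonneg_left (hbound l' k hk y) hC0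

/-- `q_s(x, ·)` is a test function. -/
theorem kernel_mem {n : ℕ} {W : WeightSeq n} {r : ℕ} (φ : TestSpace W r) (s : ℝ) (x : Euc n) :
    kernel φ.fn s x ∈ testSubmodule W r := by
  have h2 : (2 : ℝ) ^ s ≠ 0 := (Real.rpow_pos_of_pos two_pos s).ne'
  have h := (testSubmodule W r).smul_mem (((2 : ℝ) ^ (n * s) : ℝ) : ℂ)
    (TestSpace.affine_mem (kernel₀_mem φ ((2 : ℝ) ^ s • x)) h2 0)
  simp only [add_zero] at h
  exact h

/-- The multiresolution expansion of a distribution `f`, computed with the scaling function `φ`: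
`(q_s f)(x) = ⟨f(y), q_s(x,y)⟩`. -/
def Distr.multires {n : ℕ} {W : WeightSeq n} {r : ℕ} (f : Distr W r) (φ : TestSpace W r) (s : ℝ)
    (x : Euc n) : ℂ :=
  f (show TestSpace W r from ⟨kernel φ.fn s x, kernel_mem φ s x⟩)

/-- `(q_s f)(x₀) = L(2^{-s}) (q_s g_{x₀})(x₀) + o(2^{-αs} L(2^{-s}))` as `s → ∞`, where
`g_{x₀} = g(· - x₀)`. -/
def HasMultiresAsymptotics {n : ℕ} {W : WeightSeq n} {r : ℕ} (φ : TestSpace W r) (f : Distr W r)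
    (x₀ : Euc n) (α : ℝ) (L : ℝ → ℝ) (g : Distr W r) : Prop :=
  (fun s : ℝ => f.multires φ s x₀ -
      (L ((2 : ℝ) ^ (-s)) : ℂ) * (g.affine (-x₀) 1).multires φ s x₀)
    =o[atTop] fun s : ℝ => (2 : ℝ) ^ (-(α * s)) * L ((2 : ℝ) ^ (-s))

end

/-! Put `ε = 2^(-s)`. Substituting `y = x₀ + εu` turns `(q_s f)(x₀)` into the pairing of the dilate
`f(x₀ + ε·)` with `ψ_s(u) = q₀(2^s x₀, 2^s x₀ + u)` (`multires_eq_affine`). The test function `ψ_s`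
moves with `s` and need not converge, but `q₀` decays off the diagonal uniformly in its first
variable, so all `ψ_s` lie in one bounded set (`isVonNBounded_range_centredKernel`). Strong
convergence is uniform there, hence `f(x₀ + ε·)` paired with `ψ_s` equals `ε^α L(ε) (⟨g, ψ_s⟩ +
o(1))`. The limit `g` is homogeneous of degree `α` (`homogeneous`), so `ε^α ⟨g, ψ_s⟩` is the
expansion of `g_{x₀}` at `x₀`. The weights enter only through the axioms of `WeightSeq`, so one
argument serves both scales of spaces. -/

noncomputable section

/-! ### Weights of differences. -/

namespace WeightSeq

variable {n : ℕ} (W : WeightSeq n)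

theorem pos (l : ℕ) (x : Euc n) : 0 < W.w l x := zero_lt_one.trans_le (W.one_le l x)

/-- The constant in a comparison of two weights is nonnegative. -/
theorem const_nonneg {l l' : ℕ} {x y : Euc n} {C : ℝ} (h : W.w l x ≤ C * W.w l' y) : 0 ≤ C :=
  (pos_of_mul_pos_left ((W.pos l x).trans_le h) (W.pos l' y).le).le

/-- The weight of a difference, with a polynomial factor to spare in the second variable. -/
theorem sub_le_mul (l p : ℕ) : ∃ l₁ l₂ C, 0 ≤ C ∧ ∀ x y,
    W.w l (y - x) * (1 + ‖x‖) ^ p ≤ C * (W.w l₁ y * W.w l₂ x) := by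
  -- Split `y - x = y + (-x)`, absorb the reflection as scaling by `-1`, then pay for the polynomial
  -- factor with a larger index.
  obtain ⟨l₁, h₁⟩ := W.add_le l
  obtain ⟨l₂, C₂, h₂⟩ := W.smul_le l₁ (-1)
  obtain ⟨l₃, C₃, h₃⟩ := W.gain l₂ p
  have hC₂ : 0 ≤ C₂ := W.const_nonneg (h₂ 0)
  have hC₃ : 0 ≤ C₃ := W.const_nonneg (l := l₂) (x := 0) (by simpa using h₃ 0)
  refine ⟨l₁, l₃, C₂ * C₃, mul_nonneg hC₂ hC₃, fun x y => ?_⟩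
  have e₁ := h₁ y (-x)
  have e₂ := h₂ x
  rw [neg_one_smul] at e₂
  rw [← sub_eq_add_neg] at e₁
  have hy := (W.pos l₁ y).le
  calc W.w l (y - x) * (1 + ‖x‖) ^ p
      ≤ (W.w l₁ y * (C₂ * W.w l₂ x)) * (1 + ‖x‖) ^ p := by
        gcongr
        exact e₁.trans (by gcongr)
    _ = W.w l₁ y * C₂ * (W.w l₂ x * (1 + ‖x‖) ^ p) := by ring
    _ ≤ W.w l₁ y * C₂ * (C₃ * W.w l₃ x) := mul_le_mul_of_nonneg_left (h₃ x) (by positivity)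
    _ = _ := by ring

end WeightSeq

/-! ### Uniform bounds for lattice sums. -/

theorem latticePt_add {n : ℕ} (m m' : Fin n → ℤ) :
    latticePt (m + m') = latticePt m + latticePt m' := by
  ext i
  simp [latticePt]

/-- Every point of `ℝⁿ` lies within distance `√n` of the lattice. -/
theorem exists_norm_sub_latticePt_le {n : ℕ} (x : Euc n) :
    ∃ m : Fin n → ℤ, ‖x - latticePt m‖ ≤ √n := by
  -- Rounding down leaves a vector of `n` fractional parts, each of square at most 1.
  refine ⟨fun i => ⌊x i⌋, ?_⟩
  rw [EuclideanSpace.norm_eq]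
  refine Real.sqrt_le_sqrt ?_
  refine (Finset.sum_le_card_nsmul Finset.univ _ 1 fun i _ => ?_).trans (by simp)
  have h : (x - latticePt fun i => ⌊x i⌋) i = Int.fract (x i) := rfl
  rw [h, Real.norm_of_nonneg (Int.fract_nonneg _)]
  exact pow_le_one₀ (Int.fract_nonneg _) (Int.fract_lt_one _).le

/-- The sums `∑ₘ (1 + |x - m|)^{-(n+1)}` are bounded uniformly in `x`. -/
theorem exists_tsum_lattice_le (n : ℕ) : ∃ C : ℝ, ∀ x : Euc n,
    ∑' m : Fin n → ℤ, ((1 + ‖x - latticePt m‖) ^ (n + 1))⁻¹ ≤ C := by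
  refine ⟨∑' m : Fin n → ℤ,
    (1 + √n) ^ (n + 1) * ((1 + ‖(0 : Euc n) - latticePt m‖) ^ (n + 1))⁻¹, fun x => ?_⟩
  obtain ⟨k, hk⟩ := exists_norm_sub_latticePt_le x
  -- The sum is invariant under lattice shifts; shifting by `k`, which is near `x`, reduces to
  -- comparison with the sum at the origin.
  rw [← (Equiv.addRight k).tsum_eq]
  have hs : Summable fun m : Fin n → ℤ => ((1 + ‖x - latticePt (m + k)‖) ^ (n + 1))⁻¹ :=
    (summable_lattice x).comp_injective (Equiv.addRight k).injective
  refine hs.tsum_le_tsum (fun m => ?_) ((summable_lattice (0 : Euc n)).mul_left _)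
  rw [zero_sub, norm_neg, ← div_eq_mul_inv, inv_eq_one_div,
    div_le_div_iff₀ (by positivity) (by positivity), one_mul, ← mul_pow]
  gcongr
  have h : ‖latticePt m‖ ≤ ‖x - latticePt k‖ + ‖x - latticePt (m + k)‖ := by
    rw [latticePt_add]
    have e : latticePt m = (x - latticePt k) - (x - (latticePt m + latticePt k)) := by abel
    exact (congrArg _ e).trans_le (norm_sub_le _ _)
  rw [Equiv.coe_addRight]
  -- With `t = |x - (m + k)|`, this is `1 + |m| ≤ 1 + √n + t ≤ (1 + √n)(1 + t)`.
  nlinarith [mul_nonneg (Real.sqrt_nonneg n) (norm_nonneg (x - latticePt (m + k)))]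

/-! ### Off-diagonal decay of the kernel and bounded sets of test functions. -/

section Kernel

variable {n : ℕ} {W : WeightSeq n} {r : ℕ}

/-- Conjugation is a real-linear isometry, so it does not affect norms of real derivatives. -/
theorem norm_iteratedFDeriv_kernel₀_term (φ : TestSpace W r) (c : ℂ) (p y : Euc n) {k : ℕ}
    (hk : k ≤ r) :
    ‖iteratedFDeriv ℝ k (fun y => c * (starRingEnd ℂ) (φ.fn (y - p))) y‖
      = ‖c‖ * ‖iteratedFDeriv ℝ k φ.fn (y - p)‖ := by
  have hcd : ContDiff ℝ k fun y => (starRingEnd ℂ) (φ.fn (y - p)) :=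
    Complex.conjLIE.toContinuousLinearEquiv.contDiff.comp
      ((φ.contDiff.of_le (mod_cast hk)).comp (contDiff_id.sub contDiff_const))
  have e1 := iteratedFDeriv_const_smul_apply (𝕜 := ℝ) (i := k) (x := y) (a := c) hcd.contDiffAt
  have e2 := Complex.conjLIE.norm_iteratedFDeriv_comp_left (𝕜 := ℝ) (fun y => φ.fn (y - p)) y k
  have e3 : iteratedFDeriv ℝ k (fun y => φ.fn (y - p)) y = iteratedFDeriv ℝ k φ.fn (y - p) :=
    iteratedFDeriv_comp_sub k p y
  rw [e3] at e2
  change ‖iteratedFDeriv ℝ k (c • fun y => (starRingEnd ℂ) (φ.fn (y - p))) y‖ = _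
  rw [e1, norm_smul]
  congr 1

/-- `k`-th derivatives of `q₀(x, ·)` are computed termwise. -/
theorem iteratedFDeriv_kernel₀ (φ : TestSpace W r) (x y : Euc n) {k : ℕ} (hk : k ≤ r) :
    iteratedFDeriv ℝ k (kernel₀ φ.fn x) y = ∑' m : Fin n → ℤ, iteratedFDeriv ℝ k
      (fun y => φ.fn (x - latticePt m) * (starRingEnd ℂ) (φ.fn (y - latticePt m))) y := by
  -- Any index would do in place of 0: weights are at least 1, so the weighted bound dominates the
  -- bare derivatives.
  obtain ⟨B, hB, hBm⟩ := kernel₀_term_bound φ x 0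
  refine iteratedFDeriv_tsum_apply (N := (r : ℕ∞)) (v := fun _ => B)
    (fun m => ?_) (fun _ _ => hB) (fun k m y hk => ?_) (mod_cast hk) y
  · exact contDiff_const.mul (Complex.conjLIE.toContinuousLinearEquiv.contDiff.comp
      (φ.contDiff.comp (contDiff_id.sub contDiff_const)))
  · exact (le_mul_of_one_le_left (norm_nonneg _) (W.one_le 0 y)).trans
      (hBm k (mod_cast hk) m y)

/-- Off-diagonal decay of `q₀`: the weighted derivatives `w_l(y - x) |∂_y^k q₀(x,y)|` are bounded
uniformly in `x` and `y`. -/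
theorem exists_weight_sub_mul_iteratedFDeriv_kernel₀_le (φ : TestSpace W r) (l : ℕ) :
    ∃ C, ∀ k ≤ r, ∀ x y, W.w l (y - x) * ‖iteratedFDeriv ℝ k (kernel₀ φ.fn x) y‖ ≤ C := by
  -- The spare power `n + 1` is the one that makes the lattice sum converge.
  obtain ⟨l₁, l₂, C, hC, h⟩ := W.sub_le_mul l (n + 1)
  obtain ⟨K, hK⟩ := exists_tsum_lattice_le n
  set N₁ := TestSpace.norm W r l₁ φ with hN₁
  set N₂ := TestSpace.norm W r l₂ φ with hN₂
  have a₁ : 0 ≤ N₁ := apply_nonneg _ _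
  have a₂ : 0 ≤ N₂ := apply_nonneg _ _
  have hD : 0 ≤ C * (N₁ * N₂) := by positivity
  refine ⟨C * (N₁ * N₂) * K, fun k hk x y => ?_⟩
  have w0 := W.pos l (y - x)
  refine le_trans ?_ (mul_le_mul_of_nonneg_left (hK x) hD)
  rw [← tsum_mul_left, iteratedFDeriv_kernel₀ φ x y hk, mul_comm, ← le_div_iff₀ w0,
    ← tsum_div_const]
  refine tsum_of_norm_bounded
    (((summable_lattice x).mul_left _).div_const _).hasSum fun m => ?_
  rw [le_div_iff₀ w0, norm_iteratedFDeriv_kernel₀_term φ _ _ _ hk, ← div_eq_mul_inv,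
    le_div_iff₀ (by positivity)]
  set p := latticePt m
  -- Since `(y - p) - (x - p) = y - x`, the weight splits between the two factors of the term with a
  -- constant free of `x` and `p`. This is the source of uniformity in `x`.
  have e₁ := h (x - p) (y - p)
  rw [sub_sub_sub_cancel_right] at e₁
  have e₂ := φ.le_norm l₁ hk (y - p)
  have e₃ := φ.le_norm l₂ (Nat.zero_le r) (x - p)
  rw [norm_iteratedFDeriv_zero] at e₃
  calc ‖φ.fn (x - p)‖ * ‖iteratedFDeriv ℝ k φ.fn (y - p)‖ * W.w l (y - x)
        * (1 + ‖x - p‖) ^ (n + 1)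
      = (W.w l (y - x) * (1 + ‖x - p‖) ^ (n + 1))
        * (‖φ.fn (x - p)‖ * ‖iteratedFDeriv ℝ k φ.fn (y - p)‖) := by ring
    _ ≤ C * (W.w l₁ (y - p) * W.w l₂ (x - p))
        * (‖φ.fn (x - p)‖ * ‖iteratedFDeriv ℝ k φ.fn (y - p)‖) := by gcongr
    _ = C * ((W.w l₁ (y - p) * ‖iteratedFDeriv ℝ k φ.fn (y - p)‖)
        * (W.w l₂ (x - p) * ‖φ.fn (x - p)‖)) := by ring
    _ ≤ C * (N₁ * N₂) := by
        have := (W.pos l₂ (x - p)).le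
        gcongr

/-- The kernel `q₀` centred at `x`: the test function `u ↦ q₀(x, x + u)`. -/
def centredKernel (φ : TestSpace W r) (x : Euc n) : TestSpace W r :=
  TestSpace.compAffine W r 1 one_ne_zero x
    (show TestSpace W r from ⟨kernel₀ φ.fn x, kernel₀_mem φ x⟩)

/-- The factor `(1 : ℝ)` is kept so that `norm_iteratedFDeriv_affine` applies with `c = 1`. -/
theorem centredKernel_fn (φ : TestSpace W r) (x : Euc n) :
    (centredKernel φ x).fn = fun u => kernel₀ φ.fn x ((1 : ℝ) • u + x) := rfl

/-- Centring turns the off-diagonal weight `w_l(y - x)` into `w_l(u)`, so the uniform decay of `q₀`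
bounds each seminorm. This permits test functions that vary with the scale. -/
theorem isVonNBounded_range_centredKernel (φ : TestSpace W r) :
    Bornology.IsVonNBounded ℂ (Set.range (centredKernel φ)) := by
  rw [TestSpace.withSeminorms.isVonNBounded_iff_seminorm_bounded]
  intro l
  obtain ⟨C, hC⟩ := exists_weight_sub_mul_iteratedFDeriv_kernel₀_le φ l
  -- The boundedness criterion asks for a positive constant and a strict inequality.
  refine ⟨max C 0 + 1, by positivity, ?_⟩
  rintro _ ⟨x, rfl⟩
  refine lt_of_le_of_lt ?_ (lt_add_one _)
  refine (TestSpace.norm_le _ l fun k hk u => ?_).trans (le_max_left C 0)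
  have hcd : ContDiff ℝ k (kernel₀ φ.fn x) := (kernel₀_mem φ x).1.of_le (mod_cast hk)
  rw [centredKernel_fn, TestSpace.norm_iteratedFDeriv_affine hcd, abs_one, one_pow, one_mul,
    one_smul]
  simpa using hC k hk x (u + x)

end Kernel

/-! ### Multiresolution expansions as pairings with dilates. -/

namespace Distr

variable {n : ℕ} {W : WeightSeq n} {r : ℕ}

theorem affine_apply (f : Distr W r) (a : Euc n) {c : ℝ} (hc : c ≠ 0) (ψ : TestSpace W r) :
    f.affine a c ψ = (((|c| ^ n)⁻¹ : ℝ) : ℂ) *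
      f (TestSpace.compAffine W r c⁻¹ (inv_ne_zero hc) (-(c⁻¹ • a)) ψ) := by
  rw [affine, dif_neg hc]
  rfl

/-- This is `a + c(b + dx) = (a + cb) + (cd)x`, with the Jacobians multiplying. -/
theorem affine_affine (f : Distr W r) (a b : Euc n) {c d : ℝ} (hc : c ≠ 0) (hd : d ≠ 0) :
    (f.affine a c).affine b d = f.affine (a + c • b) (c * d) := by
  ext ψ
  rw [affine_apply _ _ hd, affine_apply _ _ hc, affine_apply _ _ (mul_ne_zero hc hd), ← mul_assoc]
  congr 1
  · rw [abs_mul, mul_pow, mul_inv, mul_comm]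
    push_cast
    rfl
  · congr 1
    ext x
    simp only [TestSpace.compAffine_fn]
    congr 1
    simp only [smul_add, smul_neg, smul_smul, mul_inv]
    rw [mul_right_comm c⁻¹, inv_mul_cancel₀ hc, one_mul, mul_comm d⁻¹, neg_add, add_assoc]

/-- The multiresolution expansion at `x` tests the dilates of `f` at `x` against the centred
kernels. -/
theorem multires_eq_affine (f : Distr W r) (φ : TestSpace W r) (s : ℝ) (x : Euc n) :
    f.multires φ s x = f.affine x ((2 : ℝ) ^ (-s)) (centredKernel φ ((2 : ℝ) ^ s • x)) := by
  have h2 : (2 : ℝ) ^ (-s) ≠ 0 := (Real.rpow_pos_of_pos two_pos _).ne'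
  rw [affine_apply _ _ h2, ← smul_eq_mul, ← map_smul, multires]
  congr 1
  ext y
  rw [TestSpace.fn_smul, Pi.smul_apply, TestSpace.compAffine_fn, centredKernel_fn]
  change kernel φ.fn s x y = _
  -- The Jacobian of the dilation by `2^(-s)` is exactly the normalising factor of `q_s`.
  have e : ((|(2 : ℝ) ^ (-s)| ^ n)⁻¹ : ℝ) = 2 ^ (n * s) := by
    rw [abs_of_pos (Real.rpow_pos_of_pos two_pos _), Real.rpow_neg two_pos.le, inv_pow, inv_inv,
      ← Real.rpow_natCast, ← Real.rpow_mul two_pos.le, mul_comm]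
  rw [e, Real.rpow_neg two_pos.le, inv_inv]
  simp only [one_smul, neg_add_cancel_right, kernel, smul_eq_mul]

/-- Centring `g_x` at `x` undoes the translation and leaves a pure dilation of `g`, to which
homogeneity applies. -/
theorem multires_translate (g : Distr W r) (φ : TestSpace W r) (s : ℝ) (x : Euc n) :
    (g.affine (-x) 1).multires φ s x
      = g.affine 0 ((2 : ℝ) ^ (-s)) (centredKernel φ ((2 : ℝ) ^ s • x)) := by
  have h2 : (2 : ℝ) ^ (-s) ≠ 0 := (Real.rpow_pos_of_pos two_pos _).ne'
  rw [multires_eq_affine, affine_affine _ _ _ one_ne_zero h2, one_smul, neg_add_cancel, one_mul]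

end Distr

/-! ### Homogeneity of the limit and the asymptotic expansion. -/

theorem SlowlyVarying.eventually_pos {L : ℝ → ℝ} (hL : SlowlyVarying L) :
    ∀ᶠ ε in 𝓝[>] (0 : ℝ), 0 < L ε := by
  obtain ⟨⟨A, hA, -, h⟩, -⟩ := hL
  filter_upwards [Ioc_mem_nhdsGT hA] with ε hε using h ε hε

namespace HasStrongQuasiasymptotics

variable {n : ℕ} {W : WeightSeq n} {r : ℕ} {f g : Distr W r} {x₀ : Euc n} {α : ℝ} {L : ℝ → ℝ}

theorem tendsto_apply (h : HasStrongQuasiasymptotics f x₀ α L g) (ψ : TestSpace W r) :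
    Tendsto (fun ε : ℝ => (((ε ^ α * L ε)⁻¹ : ℝ) : ℂ) * f.affine x₀ ε ψ) (𝓝[>] 0) (𝓝 (g ψ)) :=
  ((ContinuousEvalConst.continuous_eval_const ψ).tendsto g).comp h

/-- The limit distribution is homogeneous of degree `α`. -/
theorem homogeneous (h : HasStrongQuasiasymptotics f x₀ α L g) (hL : SlowlyVarying L) {a : ℝ}
    (ha : 0 < a) (ψ : TestSpace W r) : g.affine 0 a ψ = ((a ^ α : ℝ) : ℂ) * g ψ := by
  have hscale : Tendsto (fun ε : ℝ => a * ε) (𝓝[>] 0) (𝓝[>] 0) := by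
    refine tendsto_nhdsWithin_iff.2 ⟨?_, ?_⟩
    · have : Tendsto (fun ε : ℝ => a * ε) (𝓝 0) (𝓝 (a * 0)) :=
        (continuous_const_mul a).tendsto 0
      rw [mul_zero] at this
      exact this.mono_left nhdsWithin_le_nhds
    · filter_upwards [self_mem_nhdsWithin] with ε hε using mul_pos ha hε
  -- The quotient `⟨f(x₀ + aεx), ψ⟩ / (ε^α L(ε))` has two limits. Moving the dilation by `a` onto
  -- `ψ` gives `g.affine 0 a ψ`.
  have h₁ := (h.tendsto_apply (TestSpace.compAffine W r a⁻¹ (inv_ne_zero ha.ne')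
    (-(a⁻¹ • 0)) ψ)).const_mul (((|a| ^ n)⁻¹ : ℝ) : ℂ)
  rw [← Distr.affine_apply _ _ ha.ne'] at h₁
  -- Using `aε` as the scale instead produces the factor `a^α L(aε)/L(ε)`, which tends to `a^α` by
  -- slow variation.
  have h₂ := (((hL.2 a ha).const_mul (a ^ α)).ofReal).mul
    ((h.tendsto_apply ψ).comp hscale)
  rw [mul_one] at h₂
  refine tendsto_nhds_unique h₁ (h₂.congr' ?_)
  filter_upwards [self_mem_nhdsWithin, hscale.eventually hL.eventually_pos,
    hL.eventually_pos] with ε hε hLa hLε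
  have hε : 0 < ε := hε
  have e := Distr.affine_affine f x₀ 0 hε.ne' ha.ne'
  rw [smul_zero, add_zero] at e
  simp only [Function.comp]
  rw [mul_left_comm (_ : ℂ) _ (f.affine x₀ ε _), ← Distr.affine_apply _ _ ha.ne', e, mul_comm ε a,
    ← mul_assoc]
  congr 1
  norm_cast
  rw [Real.mul_rpow ha.le hε.le]
  have := (Real.rpow_pos_of_pos ha α).ne'
  have := (Real.rpow_pos_of_pos hε α).ne'
  field_simp

/-- Multiresolution expansions follow the quasiasymptotic behaviour at a point. -/
theorem hasMultiresAsymptotics (h : HasStrongQuasiasymptotics f x₀ α L g) (hL : SlowlyVarying L)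
    (φ : TestSpace W r) : HasMultiresAsymptotics φ f x₀ α L g := by
  -- Convergence in the strong topology is essential here: pointwise convergence would not control
  -- the moving test functions.
  have hunif := (UniformConvergenceCLM.tendsto_iff_tendstoUniformlyOn _ _ _).1 h
    (Set.range (centredKernel φ)) (isVonNBounded_range_centredKernel φ)
  have htwo : Tendsto (fun s : ℝ => (2 : ℝ) ^ (-s)) atTop (𝓝[>] 0) := by
    refine tendsto_nhdsWithin_iff.2 ⟨?_, .of_forall fun s => Real.rpow_pos_of_pos two_pos _⟩
    exact (tendsto_rpow_atBot_of_base_gt_one 2 one_lt_two).comp tendsto_neg_atTop_atBot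
  refine Asymptotics.isLittleO_iff.2 fun c hc => ?_
  filter_upwards [htwo.eventually (Metric.tendstoUniformlyOn_iff.1 hunif c hc),
    htwo.eventually hL.eventually_pos] with s hs hLs
  have hε : 0 < (2 : ℝ) ^ (-s) := Real.rpow_pos_of_pos two_pos _
  have hpow : (2 : ℝ) ^ (-(α * s)) = ((2 : ℝ) ^ (-s)) ^ α := by
    rw [← Real.rpow_mul two_pos.le]
    congr 1
    ring
  have hd := hs _ ⟨(2 : ℝ) ^ s • x₀, rfl⟩
  -- Both expansions are now pairings with the same centred kernel; homogeneity pulls `ε^α` out of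
  -- the one for `g`.
  rw [Distr.multires_translate, Distr.multires_eq_affine, h.homogeneous hL hε, hpow]
  set ε := (2 : ℝ) ^ (-s)
  set ψ := centredKernel φ ((2 : ℝ) ^ s • x₀)
  have hq : 0 < ε ^ α * L ε := mul_pos (Real.rpow_pos_of_pos hε α) hLs
  -- Factoring out `ε^α L(ε)`, nonzero for small `ε`, leaves the error that is uniformly below `c`.
  have e : f.affine x₀ ε ψ - (L ε : ℂ) * (((ε ^ α : ℝ) : ℂ) * g ψ)
      = ((ε ^ α * L ε : ℝ) : ℂ) * ((((ε ^ α * L ε)⁻¹ : ℝ) : ℂ) * f.affine x₀ ε ψ - g ψ) := by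
    rw [mul_sub, ← mul_assoc (_ : ℂ) _ (f.affine x₀ ε ψ), ← Complex.ofReal_mul,
      mul_inv_cancel₀ hq.ne']
    push_cast
    ring
  rw [e, norm_mul, Complex.norm_real, mul_comm]
  rw [dist_comm, dist_eq_norm] at hd
  exact mul_le_mul_of_nonneg_right hd.le (norm_nonneg _)

end HasStrongQuasiasymptotics

end

theorem theorem5p2 (n r : ℕ) (V : MRA n) (x₀ : Euc n) (α : ℝ) (L : ℝ → ℝ)
    (hL : SlowlyVarying L) :
    (∀ (M : GrowthFunction) (φ : TestSpace (expWeights M n) r),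
      IsScalingFunction (V.V 0) φ.fn →
      ∀ f g : Distr (expWeights M n) r, HasStrongQuasiasymptotics f x₀ α L g →
        HasMultiresAsymptotics φ f x₀ α L g) ∧
    (∀ φ : TestSpace (polyWeights n) r,
      IsScalingFunction (V.V 0) φ.fn →
      ∀ f g : Distr (polyWeights n) r, HasStrongQuasiasymptotics f x₀ α L g →
        HasMultiresAsymptotics φ f x₀ α L g) :=
  ⟨fun _ φ _ _ _ h => h.hasMultiresAsymptotics hL φ,
    fun φ _ _ _ h => h.hasMultiresAsymptotics hL φ⟩
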